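/- A paratopological group is a group with a topology for which multiplication is jointly continuous. For a topological space $X$, let $FP(X)$ be the (Markov) free paratopological group on $X$, that is, the paratopological group which contains $X$ as a subspace, is generated by $X$ algebraically, and is such that every continuous map from $X$ to a paratopological group $H$ extends to a continuous homomorphism $FP(X)\to H$. Let $AP(X)$ be the free abelian paratopological group on $X$, defined in the same way with all groups abelian. A subset $K$ of a space $Y$ is of countable character in $Y$ if there are open sets $U_n\supseteq K$ $(n\in\mathbb{N})$ such that every open set containing $K$ contains some $U_n$. The space $Y$ is of almost countable type if it contains a non-empty compact set of countable character in $Y$, and of countable type if every compact subset of $Y$ is contained in a compact subset of countable character in $Y$. Theorem. Let $X$ be a functionally Hausdorff space, i.e. for any two distinct points $x,y\in X$ there is a continuous function $f:X\to\mathbb{R}$ with $f(x)\neq f(y)$. The following are equivalent: (1) $FP(X)$ is of almost countable type; (2) $AP(X)$ is of almost countable type; (3) $X$ is discrete; (4) $FP(X)$ is of countable type; (5) $AP(X)$ is of countable type. -/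

import Mathlib

open Topology

/-- Distinct points are separated by a continuous real-valued function. -/
def IsFunctionallyHausdorff (X : Type*) [TopologicalSpace X] : Prop :=
  ∀ x y : X, x ≠ y → ∃ f : X → ℝ, Continuous f ∧ f x ≠ f y

/-- `K` is of countable character in `Y`: it has a countable base of open neighbourhoods. -/
def HasCountableCharacter {Y : Type*} [TopologicalSpace Y] (K : Set Y) : Prop :=
  ∃ U : ℕ → Set Y, (∀ n, IsOpen (U n) ∧ K ⊆ U n) ∧
    ∀ V : Set Y, IsOpen V → K ⊆ V → ∃ n, U n ⊆ V

/-- Every compact subset lies in a compact subset of countable character. -/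
def IsOfCountableType (Y : Type*) [TopologicalSpace Y] : Prop :=
  ∀ F : Set Y, IsCompact F → ∃ K : Set Y, F ⊆ K ∧ IsCompact K ∧ HasCountableCharacter K

/-- Some non-empty compact subset has countable character. -/
def IsOfAlmostCountableType (Y : Type*) [TopologicalSpace Y] : Prop :=
  ∃ K : Set Y, K.Nonempty ∧ IsCompact K ∧ HasCountableCharacter K

/-- The free paratopological group `FP(X)`: the free group on the set `X`, with the finest topology
for which multiplication is jointly continuous and the canonical map from `X` is continuous. The
lemmas below show that it is the Markov free paratopological group on `X`. -/
def FreeParatopGroup (X : Type*) [TopologicalSpace X] : Type _ := FreeGroup X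

namespace FreeParatopGroup

variable (X : Type*) [TopologicalSpace X]

instance : Group (FreeParatopGroup X) := inferInstanceAs (Group (FreeGroup X))

variable {X} in
/-- The canonical map from `X` to `FP(X)`. -/
def of (x : X) : FreeParatopGroup X := FreeGroup.of x

/-- The topologies making the free group on `X` a paratopological group, with `of` continuous. -/
def admissible : Set (TopologicalSpace (FreeParatopGroup X)) :=
  {t | @ContinuousMul (FreeParatopGroup X) t _ ∧ @Continuous X (FreeParatopGroup X) _ t of}

/-- In Mathlib's order finer topologies are smaller, so `sInf` is the join of all admissible
topologies. It is itself admissible, as the next two facts say. -/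
instance : TopologicalSpace (FreeParatopGroup X) := sInf (admissible X)

instance : ContinuousMul (FreeParatopGroup X) := continuousMul_sInf fun _ h => h.1

theorem continuous_of : Continuous (of : X → FreeParatopGroup X) :=
  continuous_sInf_rng.2 fun _ h => h.2

theorem closure_range_of : Subgroup.closure (Set.range (of : X → FreeParatopGroup X)) = ⊤ :=
  FreeGroup.closure_range_of X

variable {X} in
/-- Continuous maps to paratopological groups extend to continuous homomorphisms. -/
theorem exists_extension {H : Type*} [Group H] [TopologicalSpace H] [ContinuousMul H]
    (f : X → H) (hf : Continuous f) :
    ∃ φ : FreeParatopGroup X →* H, Continuous φ ∧ ∀ x, φ (of x) = f x := by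
  let φ : FreeParatopGroup X →* H := (FreeGroup.lift f : FreeGroup X →* H)
  have hφ : ∀ x, φ (of x) = f x := fun x => FreeGroup.lift_apply_of
  refine ⟨φ, continuous_iff_le_induced.2 (sInf_le ⟨continuousMul_induced φ, ?_⟩), hφ⟩
  refine continuous_induced_rng.2 ?_
  convert hf using 1
  exact funext hφ

end FreeParatopGroup

/-- The free abelian paratopological group `AP(X)`, written additively: the free abelian group on
the set `X`, with the finest topology for which addition is jointly continuous and the canonical map
from `X` is continuous. The lemmas below show that it is the Markov free abelian paratopological
group on `X`. -/
def FreeAbParatopGroup (X : Type*) [TopologicalSpace X] : Type _ := FreeAbelianGroup X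

namespace FreeAbParatopGroup

variable (X : Type*) [TopologicalSpace X]

instance : AddCommGroup (FreeAbParatopGroup X) := inferInstanceAs (AddCommGroup (FreeAbelianGroup X))

variable {X} in
/-- The canonical map from `X` to `AP(X)`. -/
def of (x : X) : FreeAbParatopGroup X := FreeAbelianGroup.of x

/-- The topologies making the free abelian group on `X` a paratopological group, with `of`
continuous. -/
def admissible : Set (TopologicalSpace (FreeAbParatopGroup X)) :=
  {t | @ContinuousAdd (FreeAbParatopGroup X) t _ ∧ @Continuous X (FreeAbParatopGroup X) _ t of}

/-- The finest admissible topology. -/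
instance : TopologicalSpace (FreeAbParatopGroup X) := sInf (admissible X)

instance : ContinuousAdd (FreeAbParatopGroup X) := continuousAdd_sInf fun _ h => h.1

theorem continuous_of : Continuous (of : X → FreeAbParatopGroup X) :=
  continuous_sInf_rng.2 fun _ h => h.2

theorem closure_range_of :
    AddSubgroup.closure (Set.range (of : X → FreeAbParatopGroup X)) = ⊤ := by
  refine eq_top_iff.2 fun g _ => ?_
  refine FreeAbelianGroup.induction_on (motive := fun g : FreeAbelianGroup X =>
    (show FreeAbParatopGroup X from g) ∈
      AddSubgroup.closure (Set.range (of : X → FreeAbParatopGroup X))) g ?_ ?_ ?_ ?_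
  · exact AddSubgroup.zero_mem _
  · exact fun x => AddSubgroup.subset_closure ⟨x, rfl⟩
  · exact fun x h => AddSubgroup.neg_mem _ h
  · exact fun x y hx hy => AddSubgroup.add_mem _ hx hy

variable {X} in
/-- Continuous maps to abelian paratopological groups extend to continuous homomorphisms. -/
theorem exists_extension {H : Type*} [AddCommGroup H] [TopologicalSpace H] [ContinuousAdd H]
    (f : X → H) (hf : Continuous f) :
    ∃ φ : FreeAbParatopGroup X →+ H, Continuous φ ∧ ∀ x, φ (of x) = f x := by
  let φ : FreeAbParatopGroup X →+ H := (FreeAbelianGroup.lift f : FreeAbelianGroup X →+ H)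
  have hφ : ∀ x, φ (of x) = f x := fun x => FreeAbelianGroup.lift_apply_of f x
  refine ⟨φ, continuous_iff_le_induced.2 (sInf_le ⟨continuousAdd_induced φ, ?_⟩), hφ⟩
  refine continuous_induced_rng.2 ?_
  convert hf using 1
  exact funext hφ

/-- `X` is a subspace of `AP(X)`. -/
theorem isEmbedding_of : IsEmbedding (of : X → FreeAbParatopGroup X) := by
  classical
  refine ⟨⟨le_antisymm (continuous_iff_le_induced.1 (continuous_of X)) fun U hU => ?_⟩,
    FreeAbelianGroup.of_injective⟩
  -- The integers with the topology of upper sets form a paratopological group.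
  let _ : TopologicalSpace ℤ := Topology.upperSet ℤ
  have : Topology.IsUpperSet ℤ := ⟨rfl⟩
  have : ContinuousAdd ℤ := by
    refine ⟨continuous_iff_continuousAt.2 fun p => ?_⟩
    rw [ContinuousAt, nhds_prod_eq, Topology.IsUpperSet.nhds_eq_principal_Ici,
      Topology.IsUpperSet.nhds_eq_principal_Ici, Topology.IsUpperSet.nhds_eq_principal_Ici,
      Filter.prod_principal_principal, Filter.tendsto_principal_principal]
    exact fun q hq => Set.mem_Ici.2 (add_le_add (Set.mem_Ici.1 hq.1) (Set.mem_Ici.1 hq.2))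
  obtain ⟨φ, hφ, hφf⟩ := exists_extension (fun x => if x ∈ U then (1 : ℤ) else 0) (by
    refine continuous_def.2 fun V hV => ?_
    have hV' : IsUpperSet V := Topology.IsUpperSet.isOpen_iff_isUpperSet.1 hV
    by_cases h0 : (0 : ℤ) ∈ V
    · have h1 : (1 : ℤ) ∈ V := hV' zero_le_one h0
      convert isOpen_univ using 1
      ext x
      by_cases hx : x ∈ U <;> simp [hx, h0, h1]
    · by_cases h1 : (1 : ℤ) ∈ V
      · convert hU using 1
        ext x
        by_cases hx : x ∈ U <;> simp [hx, h0, h1]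
      · convert isOpen_empty using 1
        ext x
        by_cases hx : x ∈ U <;> simp [hx, h0, h1])
  refine ⟨φ ⁻¹' Set.Ici 1, (Topology.IsUpperSet.isOpen_iff_isUpperSet.2
    (isUpperSet_Ici (1 : ℤ))).preimage hφ, ?_⟩
  ext x
  by_cases hx : x ∈ U <;> simp [hφf, hx]

end FreeAbParatopGroup

/-- `X` is a subspace of `FP(X)`. -/
theorem FreeParatopGroup.isEmbedding_of (X : Type*) [TopologicalSpace X] :
    IsEmbedding (of : X → FreeParatopGroup X) := by
  obtain ⟨φ, hφ, hφf⟩ := exists_extension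
    (fun x => Multiplicative.ofAdd (FreeAbParatopGroup.of x : FreeAbParatopGroup X))
    (continuous_ofAdd.comp (FreeAbParatopGroup.continuous_of X))
  refine IsEmbedding.of_comp (continuous_of X) (continuous_toAdd.comp hφ) ?_
  convert FreeAbParatopGroup.isEmbedding_of X using 1
  ext x
  simp [hφf]

/-!
If `X` is discrete then the discrete topology is admissible on the free groups, so `FP(X)` and
`AP(X)` are discrete and every compact set, being open, has countable character.

Conversely, let `K` be a non-empty compact set of countable character in `G = FP(X)` or `AP(X)`
with a neighbourhood base `(Uₙ)`, take `g ∈ K`, and suppose that `x ∈ X` is not isolated.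
Although inversion need not be continuous, `z ↦ g (x⁻¹ z) ^ m` is continuous with value `g` at `x`,
so there are `yₙ ≠ x` with `hₙ = g (x⁻¹ yₙ) ^ (4 ^ n) ∈ U₀ ∩ … ∩ Uₙ`. As `X` is functionally
Hausdorff, there is a continuous `F : X → ℝ` with `F x = 0` and `F yₙ ≥ 2⁻ⁿ` for all `n`
(`IsFunctionallyHausdorff.exists_continuous_ge_half_pow`). Its extension to a continuous
homomorphism `φ : G → ℝ` satisfies `φ hₙ ≥ φ g + 2 ^ n`, while `φ` is bounded on the compact set `K`,
hence on a neighbourhood of `K`, which contains `hₙ` for all large `n`: a contradiction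
(`discreteTopology_of_isOfAlmostCountableType`).
-/

open Filter

theorem IsOfCountableType.isOfAlmostCountableType {Y : Type*} [TopologicalSpace Y] [Nonempty Y]
    (h : IsOfCountableType Y) : IsOfAlmostCountableType Y := by
  -- A compact set containing `∅` could be empty, so start from a singleton.
  obtain ⟨K, hK, hc, hch⟩ := h {Classical.arbitrary Y} isCompact_singleton
  exact ⟨K, ⟨_, hK rfl⟩, hc, hch⟩

theorem isOfCountableType_of_discreteTopology (Y : Type*) [TopologicalSpace Y]
    [DiscreteTopology Y] : IsOfCountableType Y := fun F hF =>
  ⟨F, subset_rfl, hF, fun _ => F, fun _ => ⟨isOpen_discrete F, subset_rfl⟩, fun _ _ hV => ⟨0, hV⟩⟩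

instance FreeParatopGroup.instDiscreteTopology (X : Type*) [TopologicalSpace X]
    [DiscreteTopology X] : DiscreteTopology (FreeParatopGroup X) := by
  refine ⟨le_bot_iff.1 (sInf_le ?_)⟩
  let _ : TopologicalSpace (FreeParatopGroup X) := ⊥
  have : DiscreteTopology (FreeParatopGroup X) := ⟨rfl⟩
  exact ⟨⟨continuous_of_discreteTopology⟩, continuous_of_discreteTopology⟩

instance FreeAbParatopGroup.instDiscreteTopology (X : Type*) [TopologicalSpace X]
    [DiscreteTopology X] : DiscreteTopology (FreeAbParatopGroup X) := by
  refine ⟨le_bot_iff.1 (sInf_le ?_)⟩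
  let _ : TopologicalSpace (FreeAbParatopGroup X) := ⊥
  have : DiscreteTopology (FreeAbParatopGroup X) := ⟨rfl⟩
  exact ⟨⟨continuous_of_discreteTopology⟩, continuous_of_discreteTopology⟩

/-- A single continuous function separates a point from all terms of a sequence, with a lower bound
that does not depend on the sequence: sum suitably truncated separating functions with weights
`2⁻ⁿ`. -/
theorem IsFunctionallyHausdorff.exists_continuous_ge_half_pow {X : Type*} [TopologicalSpace X]
    (hX : IsFunctionallyHausdorff X) (x : X) (y : ℕ → X) (hy : ∀ n, y n ≠ x) :
    ∃ F : X → ℝ, Continuous F ∧ F x = 0 ∧ ∀ n, (1 / 2 : ℝ) ^ n ≤ F (y n) := by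
  choose f hf hfy using fun n => hX (y n) x (hy n)
  let u : ℕ → X → ℝ := fun n z =>
    (1 / 2 : ℝ) ^ n * min 1 (|f n z - f n x| / |f n (y n) - f n x|)
  have hu0 : ∀ n z, 0 ≤ u n z := fun n z => by positivity
  have hu1 : ∀ n z, u n z ≤ (1 / 2 : ℝ) ^ n := fun n z =>
    mul_le_of_le_one_right (by positivity) (min_le_left _ _)
  refine ⟨fun z => ∑' n, u n z, ?_, ?_, fun n => ?_⟩
  · refine continuous_tsum (fun n => ?_) summable_geometric_two fun n z => ?_
    · have := hf n
      fun_prop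
    · rw [Real.norm_of_nonneg (hu0 n z)]
      exact hu1 n z
  · simp [u]
  · have hn : u n (y n) = (1 / 2 : ℝ) ^ n := by
      have : |f n (y n) - f n x| ≠ 0 := abs_ne_zero.2 (sub_ne_zero.2 (hfy n))
      simp [u, div_self this]
    rw [← hn]
    exact (Summable.of_nonneg_of_le (fun k => hu0 k (y n)) (fun k => hu1 k (y n))
      summable_geometric_two).le_tsum n fun k _ => hu0 k (y n)

/-- Of the universal property of the free paratopological groups only the case of the target `ℝ`
is needed, which lets `FP(X)` and `AP(X)` be treated together. -/
theorem discreteTopology_of_isOfAlmostCountableType {X G : Type*} [TopologicalSpace X]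
    (hX : IsFunctionallyHausdorff X) [Group G] [TopologicalSpace G] [ContinuousMul G]
    (i : X → G) (hi : Continuous i)
    (hext : ∀ f : X → ℝ, Continuous f → ∃ φ : G →* Multiplicative ℝ,
      Continuous φ ∧ ∀ x, φ (i x) = Multiplicative.ofAdd (f x))
    (hG : IsOfAlmostCountableType G) : DiscreteTopology X := by
  obtain ⟨K, ⟨g, hg⟩, hK, U, hU, hbase⟩ := hG
  refine discreteTopology_iff_nhds_ne.2 fun x => ?_
  by_contra hx
  have : (𝓝[≠] x).NeBot := ⟨hx⟩
  have hy : ∀ n : ℕ, ∃ y, y ≠ x ∧ ∀ k ≤ n, g * ((i x)⁻¹ * i y) ^ (4 ^ n) ∈ U k := by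
    intro n
    have hev : ∀ᶠ z in 𝓝 x, ∀ k ∈ Set.Iic n, g * ((i x)⁻¹ * i z) ^ (4 ^ n) ∈ U k := by
      refine (eventually_all_finite (Set.finite_Iic n)).2 fun k _ => ?_
      have hcont : Continuous fun z => g * ((i x)⁻¹ * i z) ^ (4 ^ n) := by fun_prop
      exact hcont.continuousAt.eventually_mem
        ((hU k).1.mem_nhds (by simpa using (hU k).2 hg))
    have hne : ∀ᶠ z in 𝓝[≠] x, z ≠ x := self_mem_nhdsWithin
    obtain ⟨y, hyU, hyx⟩ := ((hev.filter_mono nhdsWithin_le_nhds).and hne).exists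
    exact ⟨y, hyx, hyU⟩
  choose y hyx hyU using hy
  obtain ⟨F, hF, hFx, hFy⟩ := hX.exists_continuous_ge_half_pow x y hyx
  obtain ⟨φ, hφ, hφi⟩ := hext F hF
  have hψ : Continuous fun z => (φ z).toAdd := continuous_toAdd.comp hφ
  obtain ⟨B, hB⟩ := hK.bddAbove_image hψ.continuousOn
  obtain ⟨N, hN⟩ := hbase {z | (φ z).toAdd < B + 1} (isOpen_lt hψ continuous_const)
    fun z hz => (hB ⟨z, hz, rfl⟩).trans_lt (lt_add_one B)
  have hpow := tendsto_pow_atTop_atTop_of_one_lt (one_lt_two (α := ℝ))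
  obtain ⟨n, hn, hNn⟩ := ((hpow.eventually_ge_atTop (B + 1 - (φ g).toAdd)).and
    (eventually_ge_atTop N)).exists
  have hlt : (φ (g * ((i x)⁻¹ * i (y n)) ^ (4 ^ n))).toAdd < B + 1 := hN (hyU n N hNn)
  simp only [map_mul, map_pow, map_inv, hφi, hFx, toAdd_mul, toAdd_pow, toAdd_inv, toAdd_ofAdd,
    neg_zero, zero_add, nsmul_eq_mul, Nat.cast_pow, Nat.cast_ofNat] at hlt
  have hmul : (4 : ℝ) ^ n * (1 / 2) ^ n = 2 ^ n := by
    rw [← mul_pow]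
    norm_num
  have := mul_le_mul_of_nonneg_left (hFy n) (by positivity : (0 : ℝ) ≤ 4 ^ n)
  linarith

theorem theorem4p3 {X : Type*} [TopologicalSpace X] (hX : IsFunctionallyHausdorff X) :
    [IsOfAlmostCountableType (FreeParatopGroup X),
      IsOfAlmostCountableType (FreeAbParatopGroup X),
      DiscreteTopology X,
      IsOfCountableType (FreeParatopGroup X),
      IsOfCountableType (FreeAbParatopGroup X)].TFAE := by
  tfae_have 1 → 3 := discreteTopology_of_isOfAlmostCountableType hX FreeParatopGroup.of
    (FreeParatopGroup.continuous_of X) fun f hf =>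
      FreeParatopGroup.exists_extension _ (continuous_ofAdd.comp hf)
  tfae_have 2 → 3 := fun h => by
    refine discreteTopology_of_isOfAlmostCountableType (G := Multiplicative (FreeAbParatopGroup X))
      hX (fun x => Multiplicative.ofAdd (FreeAbParatopGroup.of x))
      (continuous_ofAdd.comp (FreeAbParatopGroup.continuous_of X)) (fun f hf => ?_) h
    obtain ⟨φ, hφ, hφf⟩ := FreeAbParatopGroup.exists_extension f hf
    exact ⟨AddMonoidHom.toMultiplicative φ, continuous_ofAdd.comp (hφ.comp continuous_toAdd),
      fun x => congrArg Multiplicative.ofAdd (hφf x)⟩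
  tfae_have 3 → 4 := fun _ => isOfCountableType_of_discreteTopology _
  tfae_have 3 → 5 := fun _ => isOfCountableType_of_discreteTopology _
  tfae_have 4 → 1 := fun h => have : Nonempty (FreeParatopGroup X) := ⟨1⟩; h.isOfAlmostCountableType
  tfae_have 5 → 2 := fun h =>
    have : Nonempty (FreeAbParatopGroup X) := ⟨0⟩; h.isOfAlmostCountableType
  tfae_finish
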